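/- Let $(X,d)$ be a metric space with a marked point $p$ and let $n\ge 1$ be an integer. **Definitions.** A normalizing sequence is a sequence $\tilde r=(r_m)$ of positive reals with $r_m\to 0$. Sequences $\tilde x=(x_m)$, $\tilde y=(y_m)$ in $X$ are mutually stable w.r.t. $\tilde r$ if the finite limit $\tilde d_{\tilde r}(\tilde x,\tilde y)=\lim_{m\to\infty} d(x_m,y_m)/r_m$ exists. A family of sequences in $X$ is self-stable if any two of its members are mutually stable, and maximal self-stable if, in addition, every sequence in $X$ not belonging to it fails to be mutually stable with some member. If $\tilde X_{p,\tilde r}$ is a maximal self-stable family containing the constant sequence $(p,p,\dots)$, the metric identification $\Omega^X_{p,\tilde r}$ of the pseudometric space $(\tilde X_{p,\tilde r},\tilde d_{\tilde r})$ is called a pretangent space to $X$ at $p$. It is tangent if, for every subsequence $\tilde r'=(r_{m_k})$ of $\tilde r$ and every maximal self-stable (w.r.t. $\tilde r'$) family $\tilde X_{p,\tilde r'}$ containing all the sequences $(x_{m_k})_k$ with $\tilde x\in\tilde X_{p,\tilde r}$, the map $\Omega^X_{p,\tilde r}\to\Omega^X_{p,\tilde r'}$ induced by $\tilde x\mapsto(x_{m_k})_k$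 is distance-preserving and onto. For $k\ge 1$ and $x_0,\dots,x_k\in X$ let $D_k(x_0,\dots,x_k)$ be the Cayley–Menger determinant, i.e. the determinant of the symmetric $(k+2)\times(k+2)$ matrix $\begin{pmatrix}0&\mathbf 1^{T}\\ \mathbf 1&(d^2(x_i,x_j))_{i,j=0}^k\end{pmatrix}$, where $\mathbf 1$ is the column of $k+1$ ones, and put $$\Theta_{k+1}(x_0,\dots,x_k)=\frac{(-1)^{k+1}D_k(x_0,\dots,x_k)}{\bigl(\max_{0\le i\le k}d(x_i,p)\bigr)^{2k}}\ \text{ if }(x_0,\dots,x_k)\ne(p,\dots,p),\qquad \Theta_{k+1}(p,\dots,p)=0.$$ $E^l$ is the $l$-dimensional real Euclidean space, $l\ge 0$ ($E^0$ is a point). **Theorem.** Suppose that some tangent space $\Omega^X_{p,\tilde r}$ is isometrically embeddable in $E^n$ but not in $E^l$ for any integer $0\le l<n$. Then there exist sequences $\tilde x^i=(x^i_m)_{m\in\mathbb N}$, $i=0,1,\dots,n$, in $X$ such that (i) $\lim_{m\to\infty}x^0_m=\dots=\lim_{m\to\infty}x^n_m=p$ and $\min_{1\le k\le n}\ \liminf_{m\to\infty}\Theta_{k+1}(x^0_m,x^1_m,\dots,x^k_m)>0$;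 (ii) for all sequences $(y_m)$, $(u_m)$ in $X$ with $\lim_{m\to\infty} y_m=\lim_{m\to\infty} u_m=p$, $$\lim_{m\to\infty}\Theta_{n+2}(x^0_m,\dots,x^n_m,y_m)=0\quad\text{and}\quad \lim_{m\to\infty}\Theta_{n+3}(x^0_m,\dots,x^n_m,y_m,u_m)=0.$$ Conversely, if there are sequences $\tilde x^0,\dots,\tilde x^n$ in $X$ with properties (i) and (ii), then there is a pretangent space to $X$ at $p$ (for some normalizing sequence) that is isometrically embeddable in $E^n$ but not in $E^l$ for any integer $0\le l<n$. -/

import Mathlib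

open Filter Topology

universe u

/-- A normalizing sequence: a sequence of positive reals tending to zero. -/
structure NormalizingSequence where
  r : ℕ → ℝ
  pos : ∀ n, 0 < r n
  tendsto_zero : Tendsto r atTop (𝓝 0)

/-- The subsequence `r ∘ φ` of a normalizing sequence. -/
def NormalizingSequence.subseq (r : NormalizingSequence) (φ : ℕ → ℕ) (hφ : StrictMono φ) :
    NormalizingSequence where
  r := fun k => r.r (φ k)
  pos := fun k => r.pos (φ k)
  tendsto_zero := r.tendsto_zero.comp hφ.tendsto_atTop

section Pretangent

variable {X : Type u} [MetricSpace X]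

/-- Two sequences are mutually stable with respect to `r` if `d(xₙ, yₙ) / rₙ` has a finite
limit. -/
def MutuallyStable (r : NormalizingSequence) (x y : ℕ → X) : Prop :=
  ∃ L : ℝ, Tendsto (fun n => dist (x n) (y n) / r.r n) atTop (𝓝 L)

/-- A family of sequences is self-stable if any two of its members are mutually stable. -/
def SelfStable (r : NormalizingSequence) (F : Set (ℕ → X)) : Prop :=
  ∀ x ∈ F, ∀ y ∈ F, MutuallyStable r x y

/-- The value `lim d(xₙ, yₙ) / rₙ` (only used for mutually stable sequences). -/
noncomputable def scaledDist (r : NormalizingSequence) (x y : ℕ → X) : ℝ :=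
  limUnder atTop (fun n => dist (x n) (y n) / r.r n)

theorem MutuallyStable.tendsto {r : NormalizingSequence} {x y : ℕ → X}
    (h : MutuallyStable r x y) :
    Tendsto (fun n => dist (x n) (y n) / r.r n) atTop (𝓝 (scaledDist r x y)) :=
  tendsto_nhds_limUnder h

/-- A maximal self-stable family (with respect to `r`) that contains the constant
sequence `p`. -/
structure MaximalSelfStableFamily (p : X) (r : NormalizingSequence) where
  carrier : Set (ℕ → X)
  selfStable : SelfStable r carrier
  maximal : ∀ z : ℕ → X, z ∈ carrier ∨ ∃ x ∈ carrier, ¬ MutuallyStable r x z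
  const_mem : (fun _ => p) ∈ carrier

namespace MaximalSelfStableFamily

variable {p : X} {r : NormalizingSequence}

/-- The members of the family, as a type. -/
def Elem (F : MaximalSelfStableFamily p r) : Type u := {x : ℕ → X // x ∈ F.carrier}

theorem tendsto_scaledDist (F : MaximalSelfStableFamily p r) (x y : F.Elem) :
    Tendsto (fun n => dist (x.1 n) (y.1 n) / r.r n) atTop (𝓝 (scaledDist r x.1 y.1)) :=
  (F.selfStable x.1 x.2 y.1 y.2).tendsto

/-- The pseudometric `lim d(xₙ, yₙ) / rₙ` on a maximal self-stable family. -/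
noncomputable instance (F : MaximalSelfStableFamily p r) : PseudoMetricSpace F.Elem where
  dist x y := scaledDist r x.1 y.1
  dist_self x := by
    refine tendsto_nhds_unique (F.tendsto_scaledDist x x) ?_
    simp
  dist_comm x y := by
    refine tendsto_nhds_unique (F.tendsto_scaledDist x y) ?_
    simpa only [dist_comm] using F.tendsto_scaledDist y x
  dist_triangle x y z := by
    refine le_of_tendsto_of_tendsto' (F.tendsto_scaledDist x z)
      ((F.tendsto_scaledDist x y).add (F.tendsto_scaledDist y z)) fun n => ?_
    rw [← add_div]
    exact div_le_div_of_nonneg_right (dist_triangle _ _ _) (r.pos n).le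

theorem dist_def (F : MaximalSelfStableFamily p r) (x y : F.Elem) :
    dist x y = scaledDist r x.1 y.1 := rfl

/-- The pretangent space defined by the family: its metric identification. -/
abbrev PretangentSpace (F : MaximalSelfStableFamily p r) : Type u := SeparationQuotient F.Elem

/-- Restriction of sequences to the indices `φ k`, as a map into a maximal self-stable family
(with respect to the subsequence of `r`) containing all restricted sequences. -/
def restrict (F : MaximalSelfStableFamily p r) {φ : ℕ → ℕ} {hφ : StrictMono φ}
    (F' : MaximalSelfStableFamily p (r.subseq φ hφ))
    (h : ∀ x ∈ F.carrier, (fun k => x (φ k)) ∈ F'.carrier) (x : F.Elem) : F'.Elem :=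
  ⟨fun k => x.1 (φ k), h x.1 x.2⟩

theorem isometry_restrict (F : MaximalSelfStableFamily p r) {φ : ℕ → ℕ} {hφ : StrictMono φ}
    (F' : MaximalSelfStableFamily p (r.subseq φ hφ))
    (h : ∀ x ∈ F.carrier, (fun k => x (φ k)) ∈ F'.carrier) : Isometry (F.restrict F' h) := by
  refine Isometry.of_dist_eq fun x y => ?_
  exact tendsto_nhds_unique (F'.tendsto_scaledDist (F.restrict F' h x) (F.restrict F' h y))
    ((F.tendsto_scaledDist x y).comp hφ.tendsto_atTop)

/-- The map between pretangent spaces induced by restriction to a subsequence. -/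
noncomputable def restrictPretangent (F : MaximalSelfStableFamily p r) {φ : ℕ → ℕ} {hφ : StrictMono φ}
    (F' : MaximalSelfStableFamily p (r.subseq φ hφ))
    (h : ∀ x ∈ F.carrier, (fun k => x (φ k)) ∈ F'.carrier) :
    F.PretangentSpace → F'.PretangentSpace :=
  SeparationQuotient.lift (fun x => SeparationQuotient.mk (F.restrict F' h x)) fun _ _ hxy =>
    SeparationQuotient.mk_eq_mk.2 (hxy.map (F.isometry_restrict F' h).continuous)

/-- The pretangent space of `F` is tangent if, for every subsequence of `r`, the induced map
into the corresponding pretangent space is distance-preserving and onto. -/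
def IsTangent (F : MaximalSelfStableFamily p r) : Prop :=
  ∀ (φ : ℕ → ℕ) (hφ : StrictMono φ) (F' : MaximalSelfStableFamily p (r.subseq φ hφ))
    (h : ∀ x ∈ F.carrier, (fun k => x (φ k)) ∈ F'.carrier),
    Isometry (F.restrictPretangent F' h) ∧ Function.Surjective (F.restrictPretangent F' h)

end MaximalSelfStableFamily

/-- The Cayley–Menger determinant of the points `a 0, …, a k`. -/
noncomputable def cayleyMenger {k : ℕ} (a : Fin (k + 1) → X) : ℝ :=
  (Matrix.fromBlocks (Matrix.of fun _ _ => 0) (Matrix.of fun _ _ => 1)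
    (Matrix.of fun _ _ => 1) (Matrix.of fun i j => dist (a i) (a j) ^ 2) :
    Matrix (Unit ⊕ Fin (k + 1)) (Unit ⊕ Fin (k + 1)) ℝ).det

open Classical in
/-- The normalized, signed Cayley–Menger determinant `Θ_{k+1}(a 0, …, a k)` at the marked
point `p`. -/
noncomputable def theta (p : X) {k : ℕ} (a : Fin (k + 1) → X) : ℝ :=
  if a = fun _ => p then 0
  else (-1) ^ (k + 1) * cayleyMenger a /
    (Finset.univ.sup' Finset.univ_nonempty fun i => dist (a i) p) ^ (2 * k)

/-- The sequences `x 0, …, x n` tend to `p` and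
`min_{1 ≤ k ≤ n} liminf_m Θ_{k+1}(x⁰ₘ, …, xᵏₘ) > 0`; the index `k : Fin n` below stands for
the number `k + 1` of this range, and the lower limits are taken in the extended reals. -/
def IsNondegenerateFrame (p : X) {n : ℕ} (x : Fin (n + 1) → ℕ → X) : Prop :=
  (∀ i, Tendsto (x i) atTop (𝓝 p)) ∧
  0 < ⨅ k : Fin n, liminf
    (fun m => ((theta p (fun i : Fin ((k : ℕ) + 1 + 1) =>
      x (Fin.castLE (Nat.succ_le_succ k.isLt) i) m) : ℝ) : EReal)) atTop

/-- `Θ_{n+2}(x⁰ₘ, …, xⁿₘ, yₘ)` and `Θ_{n+3}(x⁰ₘ, …, xⁿₘ, yₘ, uₘ)` tend to zero for all sequences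
`y`, `u` tending to `p`. -/
def IsInfinitesimallyFlat (p : X) {n : ℕ} (x : Fin (n + 1) → ℕ → X) : Prop :=
  ∀ y u : ℕ → X, Tendsto y atTop (𝓝 p) → Tendsto u atTop (𝓝 p) →
    Tendsto (fun m => theta p
      (Fin.snoc (α := fun _ => X) (fun i => x i m) (y m) : Fin (n + 1 + 1) → X))
      atTop (𝓝 0) ∧
    Tendsto (fun m => theta p
      (Fin.snoc (α := fun _ => X)
        (Fin.snoc (α := fun _ => X) (fun i => x i m) (y m) : Fin (n + 1 + 1) → X)
        (u m) : Fin (n + 1 + 1 + 1) → X))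
      atTop (𝓝 0)

end Pretangent

/-- `Y` embeds isometrically into Euclidean `n`-space. -/
def EmbedsInEuclidean (Y : Type u) [MetricSpace Y] (n : ℕ) : Prop :=
  ∃ f : Y → EuclideanSpace ℝ (Fin n), Isometry f

/-!
The link between pretangent spaces and Cayley–Menger determinants is the identity
`neg_one_pow_mul_distDet`: up to the factor `(-1) ^ (k + 1) * 2 ^ k`, the Cayley–Menger determinant
of `k + 1` points is the determinant of the Gram matrix which the law of cosines assigns to their
distances. Hence it vanishes for more than `l + 1` points of an `l`-dimensional Euclidean space and
has the sign `(-1) ^ (k + 1)` for affinely independent points. Moreover `theta` is, up to the same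
sign, the determinant of the distances divided by the radius of the configuration around `p`
(`theta_eq_distDet`), so that limits of scaled distances give limits of `theta`.

Suppose a tangent space spans `ℝⁿ` affinely. Sequences representing `n + 1` affinely independent
points, the marked point among them, form a nondegenerate frame. Let one or two further sequences
be given. On a subsequence where the radius of the enlarged configuration is of the order of the
normalizing sequence, a diagonal choice makes the new sequences stable with the whole family, and
tangency then identifies their limits with points of the tangent space
(`IsTangent.exists_euclidean_limit`); so the limit determinant is that of too many points of `ℝⁿ`.
On a subsequence where the radius is of larger order, all points of the frame merge after scaling,
and since there are at least two of them the determinant again tends to zero.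

Conversely, take the radius of a given frame as normalizing sequence, pass to a subsequence along
which all scaled distances converge, and extend to a maximal self-stable family. The limit points
of the frame have Gram matrices with positive leading minors, hence a positive definite Gram matrix
`A`. The vanishing of the determinants with one and two added points says that the Schur complement
of `A` in the table of inner products is zero, so that all inner products are those of vectors in
`ℝⁿ` obtained from a square root of `A⁻¹` (`exists_inner_eq_of_det_append_eq_zero`). The frame itself
prevents an embedding into a space of smaller dimension.
-/

/-! ### Determinants of tables of distances -/

/-- The Cayley–Menger determinant of a table `δ` of real numbers, read as the mutual distances of
`k + 1` points. -/
noncomputable def distDet {k : ℕ} (δ : Fin (k + 1) → Fin (k + 1) → ℝ) : ℝ :=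
  (Matrix.fromBlocks (Matrix.of fun _ _ => 0) (Matrix.of fun _ _ => 1)
    (Matrix.of fun _ _ => 1) (Matrix.of fun i j => δ i j ^ 2) :
    Matrix (Unit ⊕ Fin (k + 1)) (Unit ⊕ Fin (k + 1)) ℝ).det

/-- The Gram matrix, based at the point with index `0`, that the law of cosines assigns to a table
`δ` of distances: if `δ i j = dist (v i) (v j)`, its entries are the inner products of the vectors
`v (i + 1) - v 0`. -/
noncomputable def distGram {k : ℕ} (δ : Fin (k + 1) → Fin (k + 1) → ℝ) :
    Matrix (Fin k) (Fin k) ℝ :=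
  Matrix.of fun i j => (δ i.succ 0 ^ 2 + δ 0 j.succ ^ 2 - δ i.succ j.succ ^ 2) / 2

theorem cayleyMenger_eq_distDet {X : Type u} [MetricSpace X] {k : ℕ} (a : Fin (k + 1) → X) :
    cayleyMenger a = distDet fun i j => dist (a i) (a j) := rfl

/-- Eliminating the border and the row and column of the point `0` from the Cayley–Menger matrix
leaves `-2` times the Gram matrix as a Schur complement. -/
theorem neg_one_pow_mul_distDet {k : ℕ} (δ : Fin (k + 1) → Fin (k + 1) → ℝ) (h : δ 0 0 = 0) :
    (-1) ^ (k + 1) * distDet δ = 2 ^ k * (distGram δ).det := by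
  let e₀ : Unit ⊕ Fin k ≃ Fin (k + 1) :=
    (Equiv.sumComm _ _).trans
      ((Equiv.optionEquivSumPUnit.{0, 0} (Fin k)).symm.trans (finSuccEquiv k).symm)
  let e : (Unit ⊕ Unit) ⊕ Fin k ≃ Unit ⊕ Fin (k + 1) :=
    (Equiv.sumAssoc Unit Unit (Fin k)).trans (Equiv.sumCongr (Equiv.refl _) e₀)
  let J : Matrix (Unit ⊕ Unit) (Unit ⊕ Unit) ℝ := Matrix.fromBlocks 0 1 1 0
  have hJJ : J * J = 1 := by simp [J, Matrix.fromBlocks_multiply]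
  let _ : Invertible J := ⟨J, hJJ, hJJ⟩
  let B : Matrix (Unit ⊕ Unit) (Fin k) ℝ :=
    Matrix.of fun i j => Sum.elim (fun _ => 1) (fun _ => δ 0 j.succ ^ 2) i
  let C : Matrix (Fin k) (Unit ⊕ Unit) ℝ :=
    Matrix.of fun i j => Sum.elim (fun _ => 1) (fun _ => δ i.succ 0 ^ 2) j
  let D : Matrix (Fin k) (Fin k) ℝ := Matrix.of fun i j => δ i.succ j.succ ^ 2
  have hdetJ : J.det = -1 := by
    rw [← Matrix.det_submatrix_equiv_self
      (finTwoEquiv.trans Equiv.boolEquivPUnitSumPUnit.{0, 0}), Matrix.det_fin_two]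
    simp [finTwoEquiv, J, Equiv.boolEquivPUnitSumPUnit]
  have hM : distDet δ = (Matrix.fromBlocks J B C D).det := by
    rw [distDet, ← Matrix.det_submatrix_equiv_self e]
    congr 1
    ext i j
    rcases i with (⟨⟩ | ⟨⟩) | i <;> rcases j with (⟨⟩ | ⟨⟩) | j <;>
      simp [e, e₀, J, B, C, D, h]
  have hS : D - C * ⅟J * B = (-2 : ℝ) • distGram δ := by
    ext i j
    change D i j - (C * J * B) i j = _
    simp [Matrix.mul_apply, J, B, C, D, distGram, Fintype.sum_sum_type]
    ring
  rw [hM, Matrix.det_fromBlocks₁₁, hS, Matrix.det_smul, hdetJ, Fintype.card_fin, pow_succ,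
    neg_pow (2 : ℝ) k]
  have : ((-1 : ℝ) ^ k) * (-1) ^ k = 1 := by rw [← mul_pow]; simp
  linear_combination (2 ^ k * (distGram δ).det) * this

/-- Two points that are indistinguishable in the table make the determinant vanish. -/
theorem distDet_eq_zero_of_row_eq {k : ℕ} {δ : Fin (k + 1) → Fin (k + 1) → ℝ}
    {i j : Fin (k + 1)} (hij : i ≠ j) (h : ∀ l, δ i l = δ j l) : distDet δ = 0 := by
  refine Matrix.det_zero_of_row_eq (i := Sum.inr i) (j := Sum.inr j) (by simpa using hij) ?_
  ext (l | l) <;> simp [h]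

theorem distDet_const_mul {k : ℕ} (c : ℝ) (δ : Fin (k + 1) → Fin (k + 1) → ℝ) (h : δ 0 0 = 0) :
    distDet (fun i j => c * δ i j) = c ^ (2 * k) * distDet δ := by
  have h₁ := neg_one_pow_mul_distDet δ h
  have h₂ := neg_one_pow_mul_distDet (fun i j => c * δ i j) (by simp [h])
  have hG : distGram (fun i j => c * δ i j) = (c ^ 2) • distGram δ := by
    ext i j
    simp [distGram]
    ring
  rw [hG, Matrix.det_smul, Fintype.card_fin, ← pow_mul] at h₂
  have h₃ : ((-1 : ℝ) ^ (k + 1)) ≠ 0 := by simp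
  apply mul_left_cancel₀ h₃
  linear_combination h₂ - c ^ (2 * k) * h₁

theorem continuous_distDet {k : ℕ} :
    Continuous fun δ : Fin (k + 1) → Fin (k + 1) → ℝ => distDet δ := by
  unfold distDet
  refine Continuous.matrix_det (Continuous.matrix_fromBlocks ?_ ?_ ?_ ?_) <;>
    exact continuous_matrix fun i j => by simp only [Matrix.of_apply]; fun_prop

theorem tendsto_distDet {ι : Type*} {l : Filter ι} {k : ℕ}
    {f : ι → Fin (k + 1) → Fin (k + 1) → ℝ} {δ : Fin (k + 1) → Fin (k + 1) → ℝ}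
    (h : ∀ i j, Tendsto (fun m => f m i j) l (𝓝 (δ i j))) :
    Tendsto (fun m => distDet (f m)) l (𝓝 (distDet δ)) :=
  (continuous_distDet.tendsto δ).comp
    (tendsto_pi_nhds.2 fun i => tendsto_pi_nhds.2 fun j => h i j)

section InnerProductSpace

variable {E : Type*} [NormedAddCommGroup E] [InnerProductSpace ℝ E]

theorem distGram_dist {k : ℕ} (v : Fin (k + 1) → E) :
    distGram (fun i j => dist (v i) (v j)) = Matrix.gram ℝ fun i : Fin k => v i.succ - v 0 := by
  ext i j
  have h := norm_sub_sq_real (v i.succ - v 0) (v j.succ - v 0)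
  rw [sub_sub_sub_cancel_right] at h
  simp only [distGram, Matrix.of_apply, Matrix.gram_apply, dist_eq_norm, h, norm_sub_rev (v 0)]
  ring

/-- More than `l + 1` points of a space of dimension `l` have Cayley–Menger determinant zero. -/
theorem distDet_dist_eq_zero [FiniteDimensional ℝ E] {k : ℕ} (hk : Module.finrank ℝ E < k)
    (v : Fin (k + 1) → E) : distDet (fun i j => dist (v i) (v j)) = 0 := by
  have h := neg_one_pow_mul_distDet (fun i j => dist (v i) (v j)) (dist_self _)
  have hdet : (distGram fun i j => dist (v i) (v j)).det = 0 := by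
    rw [distGram_dist]
    by_contra hne
    have := (Matrix.det_gram_ne_zero_iff_linearIndependent.1 hne).fintype_card_le_finrank
    rw [Fintype.card_fin] at this
    omega
  rw [hdet, mul_zero] at h
  exact (mul_eq_zero.1 h).resolve_left (by simp)

theorem distDet_dist_pos {k : ℕ} {v : Fin (k + 1) → E}
    (hv : LinearIndependent ℝ fun i : Fin k => v i.succ - v 0) :
    0 < (-1) ^ (k + 1) * distDet (fun i j => dist (v i) (v j)) := by
  rw [neg_one_pow_mul_distDet _ (dist_self (v 0)), distGram_dist]
  have := (Matrix.posDef_gram_of_linearIndependent hv).det_pos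
  positivity

end InnerProductSpace

/-! ### Euclidean representation of a table of inner products -/

/-- Sylvester's criterion, in the direction from positive leading minors to definiteness. -/
theorem Matrix.posDef_of_leading_minors_pos {n : ℕ} (A : Matrix (Fin n) (Fin n) ℝ)
    (hA : A.IsHermitian)
    (h : ∀ (k : ℕ) (hk : k ≤ n), 0 < (A.submatrix (Fin.castLE hk) (Fin.castLE hk)).det) :
    A.PosDef := by
  induction n with
  | zero =>
    refine Matrix.PosDef.of_dotProduct_mulVec_pos hA fun x hx => ?_
    exact absurd (Subsingleton.elim x 0) hx
  | succ n ih =>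
    set A₁ := A.submatrix (Fin.castSucc) (Fin.castSucc)
    have hpos : A₁.PosDef := by
      refine ih A₁ (hA.submatrix _) fun k hk => ?_
      exact h k (hk.trans n.le_succ)
    let e : Fin n ⊕ Fin 1 ≃ Fin (n + 1) := finSumFinEquiv
    let B : Matrix (Fin n) (Fin 1) ℝ := Matrix.of fun i _ => A i.castSucc (Fin.last n)
    let D : Matrix (Fin 1) (Fin 1) ℝ := Matrix.of fun _ _ => A (Fin.last n) (Fin.last n)
    have hsub : A.submatrix e e = Matrix.fromBlocks A₁ B B.conjTranspose D := by
      ext i j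
      rcases i with i | i <;> rcases j with j | j
      · rfl
      · fin_cases j; rfl
      · fin_cases i
        exact (hA.apply _ _).symm
      · fin_cases i; fin_cases j; rfl
    have : Invertible A₁ := hpos.isUnit.invertible
    have hdet : 0 < A.det := by simpa using h (n + 1) le_rfl
    have hschur : A.det = A₁.det * (D - B.conjTranspose * A₁⁻¹ * B).det := by
      rw [← Matrix.det_submatrix_equiv_self e, hsub, Matrix.det_fromBlocks₁₁, Matrix.invOf_eq_nonsing_inv]
    have hs : 0 < (D - B.conjTranspose * A₁⁻¹ * B).det := by
      rw [hschur] at hdet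
      exact (mul_pos_iff_of_pos_left hpos.det_pos).1 hdet
    have hS : (D - B.conjTranspose * A₁⁻¹ * B).PosSemidef := by
      have hdiag : D - B.conjTranspose * A₁⁻¹ * B =
          Matrix.diagonal fun _ => (D - B.conjTranspose * A₁⁻¹ * B).det := by
        ext i j
        fin_cases i; fin_cases j
        simp
      rw [hdiag]
      exact Matrix.PosSemidef.diagonal fun _ => hs.le
    have hpsd : A.PosSemidef := by
      have := (Matrix.PosDef.fromBlocks₁₁ B D hpos).2 hS
      rw [← hsub] at this
      exact (Matrix.posSemidef_submatrix_equiv e).1 this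
    exact hpsd.posDef_iff_det_ne_zero.2 hdet.ne'

/-- A symmetric table `g` of real numbers over a set `S` is a table of inner products in `ℝⁿ` as
soon as the determinants of the tables of `n` fixed points `a` are positive, while those of `a`
enlarged by one or two further points of `S` are zero: by the Schur complement, the residual
`h y z = g y z - bᵀ A⁻¹ c`, where `A` is the table of `a` and `b`, `c` list the products of
`y`, `z` with `a`, has `h y y = 0` and `h y y * h z z - h y z ^ 2 = 0`. -/
theorem exists_inner_eq_of_det_append_eq_zero {S : Type*} {n : ℕ} (g : S → S → ℝ)
    (hg : ∀ y z, g y z = g z y) (a : Fin n → S)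
    (hpos : ∀ (k : ℕ) (hk : k ≤ n),
      0 < (Matrix.of fun i j : Fin k => g (a (Fin.castLE hk i)) (a (Fin.castLE hk j))).det)
    (h₁ : ∀ y, (Matrix.of fun i j : Fin (n + 1) =>
      g (Fin.append a ![y] i) (Fin.append a ![y] j)).det = 0)
    (h₂ : ∀ y z, (Matrix.of fun i j : Fin (n + 2) =>
      g (Fin.append a ![y, z] i) (Fin.append a ![y, z] j)).det = 0) :
    ∃ f : S → EuclideanSpace ℝ (Fin n), ∀ y z, g y z = inner ℝ (f y) (f z) := by
  set A : Matrix (Fin n) (Fin n) ℝ := Matrix.of fun i j => g (a i) (a j) with hA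
  have hherm : A.IsHermitian := by
    ext i j
    simp [hA, hg (a i)]
  have hApos : A.PosDef := Matrix.posDef_of_leading_minors_pos A hherm hpos
  have : Invertible A := hApos.isUnit.invertible
  let b : S → Fin n → ℝ := fun y i => g (a i) y
  let h : S → S → ℝ := fun y z => g y z - b y ⬝ᵥ A⁻¹.mulVec (b z)
  have hAinv : A⁻¹.PosDef := hApos.inv
  have hsymm : ∀ y z, h y z = h z y := by
    intro y z
    have hT : A⁻¹.transpose = A⁻¹ := by
      simpa using hAinv.isHermitian.eq
    simp only [h, hg y z]
    congr 1
    rw [Matrix.dotProduct_mulVec, ← Matrix.mulVec_transpose, hT, dotProduct_comm]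
  have hdet : ∀ (q : ℕ) (w : Fin q → S),
      (Matrix.of fun i j : Fin (n + q) => g (Fin.append a w i) (Fin.append a w j)).det =
        A.det * (Matrix.of fun i j => h (w i) (w j)).det := by
    intro q w
    have hsub : (Matrix.of fun i j : Fin (n + q) =>
        g (Fin.append a w i) (Fin.append a w j)).submatrix finSumFinEquiv finSumFinEquiv =
        Matrix.fromBlocks A (Matrix.of fun i j => g (a i) (w j))
          (Matrix.of fun i j => g (w i) (a j)) (Matrix.of fun i j => g (w i) (w j)) := by
      ext i j
      rcases i with i | i <;> rcases j with j | j <;> simp [hA]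
    rw [← Matrix.det_submatrix_equiv_self finSumFinEquiv, hsub, Matrix.det_fromBlocks₁₁,
      Matrix.invOf_eq_nonsing_inv]
    congr 2
    ext i j
    simp only [h, b, Matrix.sub_apply, Matrix.of_apply, Matrix.mul_assoc, Matrix.mul_apply,
      dotProduct, Matrix.mulVec, hg (w i)]
  have hself : ∀ y, h y y = 0 := by
    intro y
    have := hdet 1 ![y]
    rw [h₁ y, Matrix.det_fin_one] at this
    simpa [hApos.det_pos.ne'] using this
  have hzero : ∀ y z, h y z = 0 := by
    intro y z
    have := hdet 2 ![y, z]
    rw [h₂ y z, Matrix.det_fin_two] at this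
    simpa [hApos.det_pos.ne', hself, hsymm z y] using this
  obtain ⟨R, hR⟩ : ∃ R : Matrix (Fin n) (Fin n) ℝ, A⁻¹ = R.conjTranspose * R := by
    open scoped MatrixOrder in
    exact CStarAlgebra.nonneg_iff_eq_star_mul_self.1 hAinv.posSemidef.nonneg
  refine ⟨fun y => WithLp.toLp 2 (R.mulVec (b y)), fun y z => ?_⟩
  have : g y z = b y ⬝ᵥ A⁻¹.mulVec (b z) := sub_eq_zero.1 (hzero y z)
  rw [this, hR, EuclideanSpace.inner_toLp_toLp, ← Matrix.mulVec_mulVec, Matrix.dotProduct_mulVec,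
    dotProduct_comm]
  simp [Matrix.vecMul_transpose]

/-! ### Limits of the normalized determinants -/

section Theta

variable {X : Type u} [MetricSpace X]

/-- The normalizing radius of `theta`: the largest distance from the marked point `p`. -/
noncomputable def maxDist (p : X) {k : ℕ} (a : Fin (k + 1) → X) : ℝ :=
  Finset.univ.sup' Finset.univ_nonempty fun i => dist (a i) p

theorem dist_le_maxDist (p : X) {k : ℕ} (a : Fin (k + 1) → X) (i : Fin (k + 1)) :
    dist (a i) p ≤ maxDist p a :=
  Finset.le_sup' (fun i => dist (a i) p) (Finset.mem_univ i)

theorem maxDist_nonneg (p : X) {k : ℕ} (a : Fin (k + 1) → X) : 0 ≤ maxDist p a :=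
  dist_nonneg.trans (dist_le_maxDist p a 0)

theorem dist_le_two_mul_maxDist (p : X) {k : ℕ} (a : Fin (k + 1) → X) (i j : Fin (k + 1)) :
    dist (a i) (a j) ≤ 2 * maxDist p a := by
  have := dist_triangle_right (a i) (a j) p
  linarith [dist_le_maxDist p a i, dist_le_maxDist p a j]

/-- For two or more points, `theta` is the signed Cayley–Menger determinant of the distances
divided by the normalizing radius. If all points equal `p` the radius is zero, and then both
sides vanish. -/
theorem theta_eq_distDet (p : X) {k : ℕ} (hk : 1 ≤ k) (a : Fin (k + 1) → X) :
    theta p a = (-1) ^ (k + 1) * distDet fun i j => (maxDist p a)⁻¹ * dist (a i) (a j) := by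
  unfold theta
  split_ifs with h
  · subst h
    have h01 : (0 : Fin (k + 1)) ≠ Fin.last k := by
      rw [Ne, Fin.ext_iff]
      simp
      omega
    rw [distDet_eq_zero_of_row_eq h01 (by simp), mul_zero]
  · rw [distDet_const_mul _ _ (dist_self (a 0)), cayleyMenger_eq_distDet, inv_pow, div_eq_mul_inv]
    change _ * (maxDist p a ^ (2 * k))⁻¹ = _
    ring

theorem tendsto_maxDist_div {ι : Type*} {l : Filter ι} {p : X} {k : ℕ}
    {a : ι → Fin (k + 1) → X} {s : ι → ℝ} {δ : Fin (k + 1) → ℝ} (hs : ∀ m, 0 < s m)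
    (h : ∀ i, Tendsto (fun m => dist (a m i) p / s m) l (𝓝 (δ i))) :
    Tendsto (fun m => maxDist p (a m) / s m) l
      (𝓝 (Finset.univ.sup' Finset.univ_nonempty δ)) := by
  have := Tendsto.finset_sup'_nhds_apply (s := (Finset.univ : Finset (Fin (k + 1))))
    Finset.univ_nonempty fun i _ => h i
  refine this.congr fun m => ?_
  refine (Finset.apply_sup'_eq_sup'_comp Finset.univ_nonempty (fun t => t / s m)
    fun x y => ?_).symm
  exact (Monotone.map_max fun x y hxy => div_le_div_of_nonneg_right hxy (hs m).le)

theorem tendsto_theta {ι : Type*} {l : Filter ι} {p : X} {k : ℕ} (hk : 1 ≤ k)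
    {a : ι → Fin (k + 1) → X} {s : ι → ℝ} {δ : Fin (k + 1) → Fin (k + 1) → ℝ} {μ : ℝ}
    (hs : ∀ m, 0 < s m) (hμ : μ ≠ 0)
    (h : ∀ i j, Tendsto (fun m => dist (a m i) (a m j) / s m) l (𝓝 (δ i j)))
    (hM : Tendsto (fun m => maxDist p (a m) / s m) l (𝓝 μ)) :
    Tendsto (fun m => theta p (a m)) l
      (𝓝 ((-1) ^ (k + 1) * distDet fun i j => μ⁻¹ * δ i j)) := by
  simp_rw [theta_eq_distDet p hk]
  refine (tendsto_distDet fun i j => ?_).const_mul _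
  refine ((hM.inv₀ hμ).mul (h i j)).congr fun m => ?_
  have := (hs m).ne'
  rw [inv_div]
  field_simp

end Theta

/-! ### Maximal self-stable families along subsequences -/

theorem exists_strictMono_forall_tendsto {J : Type*} [Countable J] (c : J → ℕ → ℝ)
    (hc : ∀ j, ∃ B, ∀ m, |c j m| ≤ B) :
    ∃ ψ : ℕ → ℕ, StrictMono ψ ∧ ∀ j, ∃ L, Tendsto (fun m => c j (ψ m)) atTop (𝓝 L) := by
  choose B hB using hc
  have hK : IsCompact (Set.univ.pi fun j => Set.Icc (-B j) (B j)) :=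
    isCompact_univ_pi fun j => isCompact_Icc
  obtain ⟨L, -, ψ, hψ, hL⟩ := hK.tendsto_subseq (x := fun m j => c j m)
    fun m j _ => abs_le.1 (hB j m)
  exact ⟨ψ, hψ, fun j => ⟨L j, tendsto_pi_nhds.1 hL j⟩⟩

theorem exists_tendsto_of_forall_approx {f : ℕ → ℝ}
    (h : ∀ ε > 0, ∃ (g : ℕ → ℝ) (L : ℝ), Tendsto g atTop (𝓝 L) ∧ ∀ᶠ m in atTop, |f m - g m| ≤ ε) :
    ∃ L, Tendsto f atTop (𝓝 L) := by
  refine cauchySeq_tendsto_of_complete (Metric.cauchySeq_iff'.2 fun ε hε => ?_)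
  obtain ⟨g, L, hg, hfg⟩ := h (ε / 8) (by positivity)
  obtain ⟨N, hN⟩ := eventually_atTop.1
    (hfg.and (Metric.tendsto_nhds.1 hg (ε / 8) (by positivity)))
  refine ⟨N, fun m hm => ?_⟩
  have h₁ := hN m hm
  have h₂ := hN N le_rfl
  rw [Real.dist_eq] at h₁ h₂ ⊢
  have h₁' := abs_le.1 h₁.1
  have h₂' := abs_le.1 h₂.1
  have h₁'' := abs_lt.1 h₁.2
  have h₂'' := abs_lt.1 h₂.2
  rw [abs_lt]
  constructor <;> linarith [h₁'.1, h₁'.2, h₂'.1, h₂'.2, h₁''.1, h₁''.2, h₂''.1, h₂''.2]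

section Pretangent

variable {X : Type u} [MetricSpace X] {p : X} {r : NormalizingSequence}

theorem MutuallyStable.refl (x : ℕ → X) : MutuallyStable r x x :=
  ⟨0, by simp⟩

theorem MutuallyStable.symm {x y : ℕ → X} (h : MutuallyStable r x y) : MutuallyStable r y x := by
  simpa only [MutuallyStable, dist_comm] using h

theorem exists_maximalSelfStableFamily {G : Set (ℕ → X)} (hG : SelfStable r G)
    (hp : (fun _ => p) ∈ G) : ∃ F : MaximalSelfStableFamily p r, G ⊆ F.carrier := by
  have hchains : ∀ c ⊆ {F : Set (ℕ → X) | SelfStable r F}, IsChain (· ⊆ ·) c → c.Nonempty →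
      ∃ ub ∈ {F : Set (ℕ → X) | SelfStable r F}, ∀ s ∈ c, s ⊆ ub := by
    refine fun c hc hchain _ => ⟨⋃₀ c, ?_, fun s hs => Set.subset_sUnion_of_mem hs⟩
    rintro x ⟨s, hs, hx⟩ y ⟨t, ht, hy⟩
    rcases hchain.total hs ht with h | h
    · exact hc ht x (h hx) y hy
    · exact hc hs x hx y (h hy)
  obtain ⟨M, hGM, hM⟩ := zorn_subset_nonempty _ hchains G hG
  refine ⟨⟨M, hM.prop, fun z => ?_, hGM hp⟩, hGM⟩
  by_contra! hz
  have hins : SelfStable r (insert z M) := by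
    rintro x (rfl | hx) y (rfl | hy)
    · exact .refl _
    · exact (hz.2 y hy).symm
    · exact hz.2 x hx
    · exact hM.prop x hx y hy
  exact hz.1 (hM.le_of_ge hins (Set.subset_insert z M) (Set.mem_insert z M))

namespace MaximalSelfStableFamily

theorem secondCountable_of_embeds {F : MaximalSelfStableFamily p r} {n : ℕ}
    (h : EmbedsInEuclidean F.PretangentSpace n) : SecondCountableTopology F.Elem := by
  obtain ⟨f, hf⟩ := h
  exact (hf.isEmbedding.isInducing.comp SeparationQuotient.isInducing_mk).secondCountableTopology

/-- The key consequence of tangency: sequences whose distances to `p` are of order at most `r`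
along a subsequence have, along a further subsequence, the limiting mutual distances of points of
any Euclidean space containing the tangent space. Separability of the tangent space allows a
diagonal choice of a subsequence along which the given sequences become mutually stable with the
whole family; surjectivity of the restriction map then leaves no room for new points. -/
theorem IsTangent.exists_euclidean_limit {F : MaximalSelfStableFamily p r} (hF : F.IsTangent)
    {n : ℕ} (hE : EmbedsInEuclidean F.PretangentSpace n) {ι : Type*} [Countable ι]
    (a : ι → ℕ → X) {φ : ℕ → ℕ} (hφ : StrictMono φ)
    (hb : ∀ i, ∃ B, ∀ m, dist (a i (φ m)) p / r.r (φ m) ≤ B) :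
    ∃ ψ : ℕ → ℕ, StrictMono ψ ∧ ∃ v : ι → EuclideanSpace ℝ (Fin n), ∀ i j,
      Tendsto (fun m => dist (a i (φ (ψ m))) (a j (φ (ψ m))) / r.r (φ (ψ m))) atTop
        (𝓝 (dist (v i) (v j))) := by
  have := secondCountable_of_embeds hE
  have : Nonempty F.Elem := ⟨⟨_, F.const_mem⟩⟩
  let w : ι ⊕ ℕ → ℕ → X := Sum.elim a fun k => (TopologicalSpace.denseSeq F.Elem k).1
  have hw : ∀ j, ∃ B, ∀ m, dist (w j (φ m)) p / r.r (φ m) ≤ B := by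
    rintro (i | k)
    · exact hb i
    · obtain ⟨B, hB⟩ := ((F.tendsto_scaledDist (TopologicalSpace.denseSeq F.Elem k)
        ⟨_, F.const_mem⟩).comp hφ.tendsto_atTop).bddAbove_range
      exact ⟨B, fun m => hB ⟨m, rfl⟩⟩
  obtain ⟨ψ, hψ, hlim⟩ := exists_strictMono_forall_tendsto
    (fun (j : ι × (ι ⊕ ℕ)) m => dist (a j.1 (φ m)) (w j.2 (φ m)) / r.r (φ m)) fun j => by
      obtain ⟨B, hB⟩ := hb j.1
      obtain ⟨B', hB'⟩ := hw j.2
      refine ⟨B + B', fun m => ?_⟩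
      rw [abs_of_nonneg (div_nonneg dist_nonneg (r.pos _).le)]
      refine le_trans ?_ (add_le_add (hB m) (hB' m))
      rw [← add_div]
      exact div_le_div_of_nonneg_right (dist_triangle_right _ _ _) (r.pos _).le
  set χ : ℕ → ℕ := φ ∘ ψ
  have hχ : StrictMono χ := hφ.comp hψ
  have hstable : ∀ i, ∀ x ∈ F.carrier,
      MutuallyStable (r.subseq χ hχ) (fun k => a i (χ k)) fun k => x (χ k) := by
    intro i x hx
    refine exists_tendsto_of_forall_approx fun ε hε => ?_
    obtain ⟨k, hk⟩ := (TopologicalSpace.denseRange_denseSeq F.Elem).exists_dist_lt ⟨x, hx⟩ hε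
    obtain ⟨L, hL⟩ := hlim (i, Sum.inr k)
    refine ⟨_, L, hL, ?_⟩
    have h := ((F.tendsto_scaledDist ⟨x, hx⟩ (TopologicalSpace.denseSeq F.Elem k)).comp
      hχ.tendsto_atTop).eventually_lt_const hk
    filter_upwards [h] with m hm
    refine le_trans ?_ hm.le
    change |dist (a i (χ m)) (x (χ m)) / r.r (χ m) -
      dist (a i (χ m)) ((TopologicalSpace.denseSeq F.Elem k).1 (χ m)) / r.r (χ m)| ≤
      dist (x (χ m)) ((TopologicalSpace.denseSeq F.Elem k).1 (χ m)) / r.r (χ m)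
    rw [← sub_div, abs_div, abs_of_pos (r.pos (χ m)), dist_comm (a i _), dist_comm (a i _)]
    exact div_le_div_of_nonneg_right (abs_dist_sub_le _ _ _) (r.pos _).le
  let G : Set (ℕ → X) :=
    (fun x k => x (χ k)) '' F.carrier ∪ Set.range fun i k => a i (χ k)
  have hG : SelfStable (r.subseq χ hχ) G := by
    rintro _ (⟨x, hx, rfl⟩ | ⟨i, rfl⟩) _ (⟨y, hy, rfl⟩ | ⟨j, rfl⟩)
    · obtain ⟨L, hL⟩ := F.selfStable x hx y hy
      exact ⟨L, hL.comp hχ.tendsto_atTop⟩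
    · exact (hstable j x hx).symm
    · exact hstable i y hy
    · exact hlim (i, Sum.inl j)
  obtain ⟨F', hF'⟩ := exists_maximalSelfStableFamily (p := p) hG
    (Or.inl ⟨fun _ => p, F.const_mem, rfl⟩)
  obtain ⟨hiso, hsurj⟩ := hF χ hχ F' fun x hx => hF' (Or.inl ⟨x, hx, rfl⟩)
  let b : ι → F'.Elem := fun i => ⟨fun k => a i (χ k), hF' (Or.inr ⟨i, rfl⟩)⟩
  choose z hz using fun i => hsurj (SeparationQuotient.mk (b i))
  obtain ⟨f, hf⟩ := hE
  refine ⟨ψ, hψ, fun i => f (z i), fun i j => ?_⟩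
  rw [hf.dist_eq, ← hiso.dist_eq, hz, hz, SeparationQuotient.dist_mk]
  exact F'.tendsto_scaledDist (b i) (b j)

/-- More than `n + 1` sequences, two of which represent distinct points of a tangent space
contained in `ℝⁿ`, have asymptotically vanishing `theta`. Along a subsequence on which the
normalizing radius is of order `r` the limiting distances are those of points of `ℝⁿ`; on one
where it is of larger order the two given sequences merge in the limit. -/
theorem IsTangent.tendsto_theta_zero {F : MaximalSelfStableFamily p r} (hF : F.IsTangent)
    {n : ℕ} (hE : EmbedsInEuclidean F.PretangentSpace n) {k : ℕ} (hk : n < k)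
    (a : Fin (k + 1) → ℕ → X) {i j : Fin (k + 1)} (hi : a i ∈ F.carrier) (hj : a j ∈ F.carrier)
    (hne : scaledDist r (a i) (a j) ≠ 0) :
    Tendsto (fun m => theta p fun i => a i m) atTop (𝓝 0) := by
  have hk1 : 1 ≤ k := by omega
  have hij : i ≠ j := by
    rintro rfl
    let b : F.Elem := ⟨a i, hi⟩
    exact hne (dist_self b)
  have hlim := F.tendsto_scaledDist ⟨a i, hi⟩ ⟨a j, hj⟩
  refine tendsto_of_subseq_tendsto fun ns hns => ?_
  obtain ⟨σ, -, hφ⟩ := strictMono_subseq_of_tendsto_atTop hns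
  set φ : ℕ → ℕ := ns ∘ σ
  let M : ℕ → ℝ := fun m => maxDist p fun i => a i m
  by_cases hb : ∃ B, ∀ m, M (φ m) / r.r (φ m) ≤ B
  · obtain ⟨B, hB⟩ := hb
    obtain ⟨ψ, hψ, v, hv⟩ := hF.exists_euclidean_limit hE
      (fun o : Option (Fin (k + 1)) => o.elim (fun _ => p) a) hφ (by
        rintro (_ | l)
        · exact ⟨0, fun m => by simp⟩
        · exact ⟨B, fun m => (div_le_div_of_nonneg_right
            (dist_le_maxDist p (fun i => a i (φ m)) l) (r.pos _).le).trans (hB m)⟩)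
    refine ⟨σ ∘ ψ, ?_⟩
    let u : Fin (k + 1) → EuclideanSpace ℝ (Fin n) := fun l => v (some l)
    have hu : dist (u i) (u j) ≠ 0 := by
      rwa [tendsto_nhds_unique (hv (some i) (some j))
        (hlim.comp ((hφ.comp hψ).tendsto_atTop))]
    set μ := Finset.univ.sup' Finset.univ_nonempty fun l => dist (u l) (v none)
    have hμ : μ ≠ 0 := by
      intro h0
      have hle : ∀ l, dist (u l) (v none) ≤ 0 := fun l =>
        h0 ▸ Finset.le_sup' (fun l => dist (u l) (v none)) (Finset.mem_univ l)
      have h₁ := dist_triangle_right (u i) (u j) (v none)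
      have h₂ := hle i
      have h₃ := hle j
      exact hu (le_antisymm (by linarith) dist_nonneg)
    have := tendsto_theta (p := p) hk1 (a := fun m i => a i (φ (ψ m)))
      (s := fun m => r.r (φ (ψ m))) (fun m => r.pos _) hμ
      (fun l l' => hv (some l) (some l'))
      (tendsto_maxDist_div (fun m => r.pos _) fun l => hv (some l) none)
    rw [distDet_const_mul _ _ (dist_self (u 0)), distDet_dist_eq_zero (by simpa using hk)] at this
    rw [mul_zero, mul_zero] at this
    exact this
  · push Not at hb
    -- A subsequence on which the radius is of larger order than `r`.
    obtain ⟨τ, hτ, hlarge⟩ : ∃ τ : ℕ → ℕ, StrictMono τ ∧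
        Tendsto (fun m => M (φ (τ m)) / r.r (φ (τ m))) atTop atTop := by
      have hfreq : ∀ N : ℕ, ∃ᶠ m in atTop, (N : ℝ) < M (φ m) / r.r (φ m) := by
        intro N hN
        have hbdd : IsBoundedUnder (· ≤ ·) atTop fun m => M (φ m) / r.r (φ m) :=
          ⟨N, eventually_map.2 (hN.mono fun m hm => not_lt.1 hm)⟩
        obtain ⟨B, hB⟩ := hbdd.bddAbove_range
        obtain ⟨m, hm⟩ := hb B
        exact absurd hm (not_lt.2 (hB ⟨m, rfl⟩))
      obtain ⟨τ, hτ, h⟩ := extraction_forall_of_frequently hfreq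
      exact ⟨τ, hτ, tendsto_atTop_mono (fun m => (h m).le) tendsto_natCast_atTop_atTop⟩
    obtain ⟨ψ, hψ, hδ⟩ := exists_strictMono_forall_tendsto
      (fun (q : Fin (k + 1) × Fin (k + 1)) m =>
        (M (φ (τ m)))⁻¹ * dist (a q.1 (φ (τ m))) (a q.2 (φ (τ m)))) fun q => by
        refine ⟨2, fun m => ?_⟩
        have h0 : 0 ≤ M (φ (τ m)) := maxDist_nonneg _ _
        rw [abs_of_nonneg (mul_nonneg (inv_nonneg.2 h0) dist_nonneg)]
        rcases h0.eq_or_lt with h | h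
        · simp [← h]
        · rw [inv_mul_le_iff₀ h, mul_comm]
          exact dist_le_two_mul_maxDist p (fun i => a i (φ (τ m))) q.1 q.2
    choose δ hδ using hδ
    refine ⟨σ ∘ τ ∘ ψ, ?_⟩
    have hmerge : δ (i, j) = 0 := by
      refine tendsto_nhds_unique (hδ (i, j)) ?_
      have h₁ := (hlarge.comp hψ.tendsto_atTop).inv_tendsto_atTop
      have h₂ := hlim.comp (hφ.comp (hτ.comp hψ)).tendsto_atTop
      have h₃ := h₁.mul h₂
      rw [zero_mul] at h₃
      refine h₃.congr fun m => ?_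
      have := (r.pos (φ (τ (ψ m)))).ne'
      simp only [Pi.inv_apply, Function.comp_apply, inv_div]
      field_simp
    have hrow : ∀ l, δ (i, l) = δ (j, l) := by
      intro l
      have h₀ : Tendsto (fun m => (M (φ (τ (ψ m))))⁻¹ * dist (a i (φ (τ (ψ m))))
          (a l (φ (τ (ψ m)))) - (M (φ (τ (ψ m))))⁻¹ * dist (a j (φ (τ (ψ m))))
          (a l (φ (τ (ψ m))))) atTop (𝓝 0) := by
        refine squeeze_zero_norm (fun m => ?_) (hmerge ▸ hδ (i, j))
        have h0 : 0 ≤ M (φ (τ (ψ m))) := maxDist_nonneg _ _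
        rw [← mul_sub, norm_mul, Real.norm_of_nonneg (inv_nonneg.2 h0)]
        exact mul_le_mul_of_nonneg_left (abs_dist_sub_le _ _ _) (inv_nonneg.2 h0)
      exact sub_eq_zero.1 (tendsto_nhds_unique ((hδ (i, l)).sub (hδ (j, l))) h₀)
    have := (tendsto_distDet fun q q' => hδ (q, q')).const_mul ((-1 : ℝ) ^ (k + 1))
    rw [distDet_eq_zero_of_row_eq (δ := fun q q' => δ (q, q')) hij hrow, mul_zero] at this
    exact this.congr fun m => (theta_eq_distDet p hk1 _).symm

end MaximalSelfStableFamily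

end Pretangent

/-! ### From a tangent space to sequences -/

section Pretangent

variable {X : Type u} [MetricSpace X] {p : X} {r : NormalizingSequence}

namespace MaximalSelfStableFamily

theorem tendsto_of_mem (F : MaximalSelfStableFamily p r) (y : F.Elem) :
    Tendsto y.1 atTop (𝓝 p) := by
  rw [tendsto_iff_dist_tendsto_zero]
  have := (F.tendsto_scaledDist y ⟨_, F.const_mem⟩).mul r.tendsto_zero
  rw [mul_zero] at this
  exact this.congr fun m => div_mul_cancel₀ _ (r.pos m).ne'

/-- If `n` is the least dimension of a Euclidean space containing the pretangent space, then `n + 1`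
of its points, one of them the marked point, are affinely independent there. -/
theorem exists_affine_frame (F : MaximalSelfStableFamily p r) {n : ℕ}
    (hE : EmbedsInEuclidean F.PretangentSpace n)
    (hmin : ∀ l < n, ¬ EmbedsInEuclidean F.PretangentSpace l) :
    ∃ (x : Fin (n + 1) → F.Elem) (v : Fin (n + 1) → EuclideanSpace ℝ (Fin n)),
      x 0 = ⟨_, F.const_mem⟩ ∧ (∀ i j, dist (v i) (v j) = dist (x i) (x j)) ∧
      LinearIndependent ℝ fun i : Fin n => v i.succ - v 0 := by
  obtain ⟨f, hf⟩ := hE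
  let p₀ : F.Elem := ⟨_, F.const_mem⟩
  set o := f (SeparationQuotient.mk p₀)
  let s : Set (EuclideanSpace ℝ (Fin n)) := Set.range fun z => f z - o
  have hfin : Module.finrank ℝ (Submodule.span ℝ s) = n := by
    by_contra hne
    have hlt : Module.finrank ℝ (Submodule.span ℝ s) < n :=
      lt_of_le_of_ne ((Submodule.finrank_le _).trans_eq (by simp)) hne
    refine hmin _ hlt ⟨fun z => (stdOrthonormalBasis ℝ (Submodule.span ℝ s)).repr
      ⟨f z - o, Submodule.subset_span ⟨z, rfl⟩⟩, ?_⟩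
    refine (LinearIsometryEquiv.isometry _).comp (Isometry.of_dist_eq fun y z => ?_)
    rw [Subtype.dist_eq, dist_sub_right, hf.dist_eq]
  have hw := Submodule.exists_fun_fin_finrank_span_eq ℝ s
  rw [hfin] at hw
  obtain ⟨w, hws, -, hli⟩ := hw
  choose z hz using hws
  choose y hy using fun i => SeparationQuotient.surjective_mk (z i)
  refine ⟨Fin.cons p₀ y, fun i => f (SeparationQuotient.mk (Fin.cons (α := fun _ => F.Elem) p₀ y i)),
    rfl, fun i j => ?_, ?_⟩
  · rw [hf.dist_eq, SeparationQuotient.dist_mk]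
  · simp only [Fin.cons_succ, Fin.cons_zero, hy]
    exact (funext hz : (fun i => f (z i) - o) = w) ▸ hli

theorem IsTangent.exists_frame {F : MaximalSelfStableFamily p r} (hF : F.IsTangent) {n : ℕ}
    (hn : 1 ≤ n) (hE : EmbedsInEuclidean F.PretangentSpace n)
    (hmin : ∀ l < n, ¬ EmbedsInEuclidean F.PretangentSpace l) :
    ∃ x : Fin (n + 1) → ℕ → X, IsNondegenerateFrame p x ∧ IsInfinitesimallyFlat p x := by
  obtain ⟨x, v, hx₀, hv, hli⟩ := F.exists_affine_frame hE hmin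
  have hne : ∀ i : Fin n, 0 < dist (x i.succ) (x 0) := by
    intro i
    rw [← hv, dist_pos, ← sub_ne_zero]
    exact hli.ne_zero i
  refine ⟨fun i => (x i).1, ⟨fun i => F.tendsto_of_mem (x i), ?_⟩, fun y u _ _ => ⟨?_, ?_⟩⟩
  · have : Nonempty (Fin n) := ⟨⟨0, hn⟩⟩
    obtain ⟨k, hk⟩ := exists_eq_ciInf_of_finite (f := fun k : Fin n => liminf
      (fun m => ((theta p (fun i : Fin ((k : ℕ) + 1 + 1) =>
        (x (Fin.castLE (Nat.succ_le_succ k.isLt) i)).1 m) : ℝ) : EReal)) atTop)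
    rw [← hk]
    let e : Fin ((k : ℕ) + 1 + 1) → Fin (n + 1) := Fin.castLE (Nat.succ_le_succ k.isLt)
    have he : e 1 = Fin.succ ⟨0, hn⟩ := rfl
    set μ := Finset.univ.sup' Finset.univ_nonempty fun i => dist (x (e i)) (x 0)
    have hμ : 0 < μ :=
      (hne ⟨0, hn⟩).trans_le
        (he ▸ Finset.le_sup' (fun i => dist (x (e i)) (x 0)) (Finset.mem_univ 1))
    have hlim := tendsto_theta (p := p) (k := k + 1) (by omega) (a := fun m i => (x (e i)).1 m)
      r.pos hμ.ne' (fun i j => F.tendsto_scaledDist (x (e i)) (x (e j)))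
      (tendsto_maxDist_div r.pos fun i => by
        have := F.tendsto_scaledDist (x (e i)) (x 0)
        rw [hx₀] at this ⊢
        exact this)
    have hlim' := (continuous_coe_real_ereal.tendsto _).comp hlim
    refine lt_of_lt_of_eq ?_ hlim'.liminf_eq.symm
    rw [EReal.coe_pos]
    have hpos : 0 < (-1) ^ (k + 1 + 1 : ℕ) * distDet fun i j => dist (v (e i)) (v (e j)) :=
      distDet_dist_pos (v := v ∘ e)
        (hli.comp (Fin.castLE k.isLt : Fin (k + 1) → Fin n) (Fin.castLE_injective _))
    have hc := distDet_const_mul μ⁻¹ (fun i j => dist (x (e i)) (x (e j))) (dist_self _)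
    simp only [hv] at hpos
    change 0 < (-1) ^ (k + 1 + 1 : ℕ) * distDet fun i j => μ⁻¹ * dist (x (e i)) (x (e j))
    rw [hc, mul_left_comm]
    positivity
  · refine (hF.tendsto_theta_zero hE (k := n + 1) (by omega)
      (Fin.snoc (α := fun _ => ℕ → X) (fun i => (x i).1) y)
      (i := Fin.castSucc (Fin.succ ⟨0, hn⟩)) (j := Fin.castSucc 0) ?_ ?_ ?_).congr fun m => ?_
    · rw [Fin.snoc_castSucc]; exact (x _).2
    · rw [Fin.snoc_castSucc]; exact (x _).2
    · rw [Fin.snoc_castSucc, Fin.snoc_castSucc]; exact (hne _).ne'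
    · congr 1
      ext i
      refine Fin.lastCases ?_ (fun i => ?_) i <;> simp
  · refine (hF.tendsto_theta_zero hE (k := n + 2) (by omega)
      (Fin.snoc (α := fun _ => ℕ → X) (Fin.snoc (α := fun _ => ℕ → X) (fun i => (x i).1) y) u)
      (i := (Fin.succ ⟨0, hn⟩).castSucc.castSucc) (j := (0 : Fin (n + 1)).castSucc.castSucc)
      ?_ ?_ ?_).congr fun m => ?_
    · rw [Fin.snoc_castSucc, Fin.snoc_castSucc]; exact (x _).2
    · rw [Fin.snoc_castSucc, Fin.snoc_castSucc]; exact (x _).2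
    · rw [Fin.snoc_castSucc, Fin.snoc_castSucc, Fin.snoc_castSucc, Fin.snoc_castSucc]
      exact (hne _).ne'
    · congr 1
      ext i
      refine Fin.lastCases ?_ (fun i => ?_) i
      · simp
      · refine Fin.lastCases ?_ (fun i => ?_) i <;> simp

end MaximalSelfStableFamily

end Pretangent

/-! ### From sequences to a pretangent space -/

theorem distDet_eq_zero_of_dist_eq_zero {S : Type*} [PseudoMetricSpace S] {k : ℕ}
    {b : Fin (k + 1) → S} {i j : Fin (k + 1)} (hij : i ≠ j) (h : dist (b i) (b j) = 0) :
    distDet (fun i j => dist (b i) (b j)) = 0 :=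
  distDet_eq_zero_of_row_eq hij fun l => by
    have h₁ := dist_triangle (b i) (b j) (b l)
    have h₂ := dist_triangle_left (b j) (b l) (b i)
    linarith

/-- A pseudometric space whose Cayley–Menger determinants have the alternating signs of
independent points on `a 0, …, a n`, and vanish when one or two points are added to these, maps
isometrically to `ℝⁿ`. -/
theorem exists_isometry_of_distDet {S : Type*} [PseudoMetricSpace S] {n : ℕ} (a : Fin (n + 1) → S)
    (hpos : ∀ (k : ℕ) (hk : k ≤ n), 1 ≤ k → 0 < (-1) ^ (k + 1) * distDet fun i j : Fin (k + 1) =>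
      dist (a (Fin.castLE (Nat.succ_le_succ hk) i)) (a (Fin.castLE (Nat.succ_le_succ hk) j)))
    (h₁ : ∀ y, (distDet fun i j : Fin (n + 1 + 1) =>
      dist (Fin.snoc (α := fun _ => S) a y i) (Fin.snoc (α := fun _ => S) a y j)) = 0)
    (h₂ : ∀ y z, (distDet fun i j : Fin (n + 1 + 1 + 1) =>
      dist (Fin.snoc (α := fun _ => S) (Fin.snoc (α := fun _ => S) a y : Fin (n + 1 + 1) → S) z i)
        (Fin.snoc (α := fun _ => S) (Fin.snoc (α := fun _ => S) a y : Fin (n + 1 + 1) → S) z j))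
        = 0) :
    ∃ f : S → EuclideanSpace ℝ (Fin n), Isometry f := by
  let g : S → S → ℝ := fun y z => (dist y (a 0) ^ 2 + dist (a 0) z ^ 2 - dist y z ^ 2) / 2
  have ha : Fin.cons (α := fun _ => S) (a 0) (fun i : Fin n => a i.succ) = a := Fin.cons_self_tail a
  have hzero : ∀ {q : ℕ} (w : Fin q → S) (b : Fin (n + q + 1) → S),
      b = Fin.cons (a 0) (Fin.append (fun i : Fin n => a i.succ) w) →
      (distDet fun i j => dist (b i) (b j)) = 0 →
      (Matrix.of fun i j : Fin (n + q) => g (Fin.append (fun i : Fin n => a i.succ) w i)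
        (Fin.append (fun i : Fin n => a i.succ) w j)).det = 0 := by
    intro q w b hbw hb
    have h := neg_one_pow_mul_distDet (fun i j => dist (b i) (b j)) (dist_self (b 0))
    rw [hb, mul_zero] at h
    subst hbw
    exact (mul_eq_zero.1 h.symm).resolve_left (by positivity)
  obtain ⟨f, hf⟩ := exists_inner_eq_of_det_append_eq_zero g
    (fun y z => by simp only [g, dist_comm]; ring) (fun i : Fin n => a i.succ)
    (fun k hk => by
      rcases k.eq_zero_or_pos with rfl | hk0
      · simp
      · have h := hpos k hk hk0
        rw [neg_one_pow_mul_distDet _ (dist_self (a _))] at h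
        exact (mul_pos_iff_of_pos_left (by positivity)).1 h)
    (fun y => hzero ![y] _ (by
      rw [Fin.append_right_eq_snoc, Fin.cons_snoc_eq_snoc_cons, ha]; rfl) (h₁ y))
    (fun y z => hzero ![y, z] _ (by
      have : (![y, z] : Fin 2 → S) = Fin.snoc (α := fun _ => S) ![y] z := by
        ext i; fin_cases i <;> rfl
      rw [this, Fin.append_snoc, Fin.cons_snoc_eq_snoc_cons, Fin.append_right_eq_snoc,
        Fin.cons_snoc_eq_snoc_cons, ha]; rfl) (h₂ y z))
  refine ⟨f, Isometry.of_dist_eq fun y z => ?_⟩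
  rw [← sq_eq_sq₀ dist_nonneg dist_nonneg, dist_eq_norm, norm_sub_sq_real,
    ← real_inner_self_eq_norm_sq, ← real_inner_self_eq_norm_sq, ← hf, ← hf, ← hf]
  simp only [g, dist_self, dist_comm (a 0)]
  ring

/-- Multiplying `theta` by a power of the scaled normalizing radius gives the Cayley–Menger
determinant of the scaled distances, also when the radius is zero. -/
theorem theta_mul_maxDist_div_pow {X : Type u} [MetricSpace X] (p : X) {k : ℕ} (hk : 1 ≤ k)
    (a : Fin (k + 1) → X) (s : ℝ) :
    theta p a * (maxDist p a / s) ^ (2 * k) =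
      (-1) ^ (k + 1) * distDet fun i j => dist (a i) (a j) / s := by
  have hs : (fun i j => dist (a i) (a j) / s) = fun i j => s⁻¹ * dist (a i) (a j) := by
    ext i j
    rw [div_eq_inv_mul]
  rw [hs, theta_eq_distDet p hk, distDet_const_mul _ _ (dist_self (a 0)),
    distDet_const_mul _ _ (dist_self (a 0))]
  rcases eq_or_ne (maxDist p a) 0 with h | h
  · have h01 : (0 : Fin (k + 1)) ≠ Fin.last k := by
      rw [Ne, Fin.ext_iff]
      simp
      omega
    have hd : dist (a 0) (a (Fin.last k)) = 0 :=
      le_antisymm (by simpa [h] using dist_le_two_mul_maxDist p a 0 (Fin.last k)) dist_nonneg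
    simp [distDet_eq_zero_of_dist_eq_zero h01 hd]
  · rw [div_eq_mul_inv, mul_pow, inv_pow]
    field_simp

theorem StrictMono.tendsto_extend {α : Type*} {l : Filter α} {φ : ℕ → ℕ} (hφ : StrictMono φ)
    {y : ℕ → α} {p : α} (hp : pure p ≤ l) (hy : Tendsto y atTop l) :
    Tendsto (Function.extend φ y fun _ => p) atTop l := by
  intro s hs
  obtain ⟨N, hN⟩ := eventually_atTop.1 (hy hs)
  refine eventually_atTop.2 ⟨φ N, fun m hm => ?_⟩
  by_cases h : ∃ k, φ k = m
  · obtain ⟨k, rfl⟩ := h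
    change Function.extend φ y (fun _ => p) (φ k) ∈ s
    rw [hφ.injective.extend_apply]
    exact hN k (hφ.le_iff_le.1 hm)
  · change Function.extend φ y (fun _ => p) m ∈ s
    rw [Function.extend_apply' _ _ _ h]
    exact hp hs

section Pretangent

variable {X : Type u} [MetricSpace X] {p : X} {r : NormalizingSequence}

theorem IsNondegenerateFrame.exists_lower_bound {n : ℕ} {x : Fin (n + 1) → ℕ → X}
    (hx : IsNondegenerateFrame p x) {k : ℕ} (hk : k ≤ n) (hk1 : 1 ≤ k) :
    ∃ c : ℝ, 0 < c ∧ ∀ᶠ m in atTop, c ≤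
      theta p (fun i : Fin (k + 1) => x (Fin.castLE (Nat.succ_le_succ hk) i) m) := by
  obtain ⟨k, rfl⟩ : ∃ k', k = k' + 1 := ⟨k - 1, by omega⟩
  have h := hx.2.trans_le (iInf_le _ (⟨k, hk⟩ : Fin n))
  obtain ⟨c, hc0, hc⟩ := EReal.lt_iff_exists_real_btwn.1 h
  refine ⟨c, EReal.coe_pos.1 hc0, (eventually_lt_of_lt_liminf hc).mono fun m hm => ?_⟩
  exact (EReal.coe_lt_coe_iff.1 hm).le

namespace MaximalSelfStableFamily

theorem tendsto_theta_mul (F : MaximalSelfStableFamily p r) {k : ℕ} (hk : 1 ≤ k)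
    (b : Fin (k + 1) → F.Elem) :
    Tendsto (fun m => theta p (fun i => (b i).1 m) *
      (maxDist p (fun i => (b i).1 m) / r.r m) ^ (2 * k)) atTop
      (𝓝 ((-1) ^ (k + 1) * distDet fun i j => dist (b i) (b j))) := by
  simp_rw [theta_mul_maxDist_div_pow p hk]
  exact (tendsto_distDet fun i j => F.tendsto_scaledDist (b i) (b j)).const_mul _

theorem tendsto_maxDist (F : MaximalSelfStableFamily p r) {k : ℕ} (b : Fin (k + 1) → F.Elem) :
    Tendsto (fun m => maxDist p (fun i => (b i).1 m) / r.r m) atTop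
      (𝓝 (Finset.univ.sup' Finset.univ_nonempty fun i => dist (b i) ⟨_, F.const_mem⟩)) :=
  tendsto_maxDist_div r.pos fun i => F.tendsto_scaledDist (b i) ⟨_, F.const_mem⟩

theorem distDet_eq_zero_of_tendsto_theta (F : MaximalSelfStableFamily p r) {k : ℕ} (hk : 1 ≤ k)
    (b : Fin (k + 1) → F.Elem)
    (h : Tendsto (fun m => theta p fun i => (b i).1 m) atTop (𝓝 0)) :
    (distDet fun i j => dist (b i) (b j)) = 0 := by
  have h₁ := h.mul ((F.tendsto_maxDist b).pow (2 * k))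
  rw [zero_mul] at h₁
  have h₂ := tendsto_nhds_unique (F.tendsto_theta_mul hk b) h₁
  exact (mul_eq_zero.1 h₂).resolve_left (by simp)

theorem distDet_pos_of_theta_ge (F : MaximalSelfStableFamily p r) {k : ℕ} (hk : 1 ≤ k)
    (b : Fin (k + 1) → F.Elem) {c : ℝ} (hc : 0 < c)
    (h : ∀ᶠ m in atTop, c ≤ theta p fun i => (b i).1 m) {i : Fin (k + 1)}
    (hi : 0 < dist (b i) ⟨_, F.const_mem⟩) :
    0 < (-1) ^ (k + 1) * distDet fun i j => dist (b i) (b j) := by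
  have hR := hi.trans_le (Finset.le_sup' (fun i => dist (b i) (⟨_, F.const_mem⟩ : F.Elem))
    (Finset.mem_univ i))
  refine lt_of_lt_of_le (mul_pos hc (pow_pos hR (2 * k))) (le_of_tendsto_of_tendsto
    (((F.tendsto_maxDist b).pow (2 * k)).const_mul c) (F.tendsto_theta_mul hk b) ?_)
  filter_upwards [h] with m hm
  exact mul_le_mul_of_nonneg_right hm
    (pow_nonneg (div_nonneg (maxDist_nonneg _ _) (r.pos m).le) _)

/-- With the normalizing radius of a nondegenerate frame as normalizing sequence, all scaled
distances in the frame are bounded, so that along a subsequence the frame and the marked point lie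
in a common maximal self-stable family. -/
theorem exists_of_isNondegenerateFrame {n : ℕ} (hn : 1 ≤ n) {x : Fin (n + 1) → ℕ → X}
    (hx : IsNondegenerateFrame p x) :
    ∃ (r : NormalizingSequence) (F : MaximalSelfStableFamily p r) (φ : ℕ → ℕ)
      (a : Fin (n + 1) → F.Elem), StrictMono φ ∧ (∀ i m, (a i).1 m = x i (φ m)) ∧
      ∃ i, 0 < dist (a i) ⟨_, F.const_mem⟩ := by
  let M : ℕ → ℝ := fun m => maxDist p fun i => x i m
  obtain ⟨c, hc, hev⟩ := hx.exists_lower_bound le_rfl hn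
  obtain ⟨N, hN⟩ := eventually_atTop.1 hev
  have hMpos : ∀ m, N ≤ m → 0 < M m := by
    intro m hm
    refine (maxDist_nonneg _ _).lt_of_ne fun h0 => ?_
    have hp : (fun i => x i m) = fun _ => p := by
      ext i
      exact dist_le_zero.1 ((dist_le_maxDist p (fun i => x i m) i).trans_eq h0.symm)
    have hθ : c ≤ theta p fun i => x i m := hN m hm
    rw [hp, theta, if_pos rfl] at hθ
    exact absurd hc (not_lt.2 hθ)
  have hM0 : Tendsto M atTop (𝓝 0) := by
    have := tendsto_maxDist_div (p := p) (a := fun m i => x i m) (s := fun _ => 1)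
      (fun _ => one_pos) fun i => by
        simpa using tendsto_iff_dist_tendsto_zero.1 (hx.1 i)
    simpa using this
  let w : Option (Fin (n + 1)) → ℕ → X := fun o => o.elim (fun _ => p) x
  have hw : ∀ o m, dist (w o m) p ≤ M m := by
    rintro (_ | i) m
    · simpa [w] using maxDist_nonneg p fun i => x i m
    · exact dist_le_maxDist p (fun i => x i m) i
  obtain ⟨ψ, hψ, hlim⟩ := exists_strictMono_forall_tendsto
    (fun (q : Option (Fin (n + 1)) × Option (Fin (n + 1))) m =>
      dist (w q.1 (m + N)) (w q.2 (m + N)) / M (m + N)) fun q => ⟨2, fun m => by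
        have hpos := hMpos (m + N) (Nat.le_add_left _ _)
        rw [abs_of_nonneg (div_nonneg dist_nonneg hpos.le), div_le_iff₀ hpos]
        linarith [dist_triangle_right (w q.1 (m + N)) (w q.2 (m + N)) p, hw q.1 (m + N),
          hw q.2 (m + N)]⟩
  let φ : ℕ → ℕ := fun m => ψ m + N
  have hφ : StrictMono φ := fun i j hij => Nat.add_lt_add_right (hψ hij) N
  let r : NormalizingSequence :=
    ⟨fun m => M (φ m), fun m => hMpos _ (Nat.le_add_left _ _), hM0.comp hφ.tendsto_atTop⟩
  have hG : SelfStable r (Set.range fun o m => w o (φ m)) := by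
    rintro _ ⟨o, rfl⟩ _ ⟨o', rfl⟩
    exact hlim (o, o')
  obtain ⟨F, hF⟩ := exists_maximalSelfStableFamily (p := p) hG ⟨none, rfl⟩
  let a : Fin (n + 1) → F.Elem := fun i => ⟨fun m => x i (φ m), hF ⟨some i, rfl⟩⟩
  refine ⟨r, F, φ, a, hφ, fun _ _ => rfl, ?_⟩
  have h₁ : Tendsto (fun m => maxDist p (fun i => (a i).1 m) / r.r m) atTop (𝓝 1) :=
    tendsto_const_nhds.congr fun m => (div_self (r.pos m).ne').symm
  have h₂ := tendsto_nhds_unique (F.tendsto_maxDist a) h₁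
  obtain ⟨i, -, hi⟩ := Finset.exists_mem_eq_sup' Finset.univ_nonempty
    fun i => dist (a i) (⟨_, F.const_mem⟩ : F.Elem)
  exact ⟨i, by rw [← hi, h₂]; exact one_pos⟩

/-- Positivity of the determinants of a frame passes to the limit because the radii of its initial
segments stay comparable to the full radius, and flatness gives the vanishing determinants, so that
the pretangent space is a subset of `ℝⁿ` containing `n + 1` affinely independent points. -/
theorem exists_embeds_of_frame {n : ℕ} (hn : 1 ≤ n) {x : Fin (n + 1) → ℕ → X}
    (hx : IsNondegenerateFrame p x) (hflat : IsInfinitesimallyFlat p x) :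
    ∃ (r : NormalizingSequence) (F : MaximalSelfStableFamily p r),
      EmbedsInEuclidean F.PretangentSpace n ∧
      ∀ l < n, ¬ EmbedsInEuclidean F.PretangentSpace l := by
  obtain ⟨r, F, φ, a, hφ, ha, i₀, hi₀⟩ := exists_of_isNondegenerateFrame hn hx
  have hbound : ∀ (k : ℕ) (hk : k ≤ n), 1 ≤ k → ∃ c : ℝ, 0 < c ∧ ∀ᶠ m in atTop,
      c ≤ theta p fun i : Fin (k + 1) => (a (Fin.castLE (Nat.succ_le_succ hk) i)).1 m := by
    intro k hk hk1
    obtain ⟨c, hc, h⟩ := hx.exists_lower_bound hk hk1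
    refine ⟨c, hc, (hφ.tendsto_atTop.eventually h).mono fun m hm => ?_⟩
    simpa only [ha] using hm
  have htop : 0 < (-1) ^ (n + 1) * distDet fun i j => dist (a i) (a j) := by
    obtain ⟨c, hc, h⟩ := hbound n le_rfl hn
    exact F.distDet_pos_of_theta_ge hn a hc h hi₀
  have hne : (distDet fun i j => dist (a i) (a j)) ≠ 0 := by
    intro h0
    simp [h0] at htop
  have hpos : ∀ (k : ℕ) (hk : k ≤ n), 1 ≤ k → 0 < (-1) ^ (k + 1) *
      distDet fun i j : Fin (k + 1) => dist (a (Fin.castLE (Nat.succ_le_succ hk) i))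
        (a (Fin.castLE (Nat.succ_le_succ hk) j)) := by
    intro k hk hk1
    obtain ⟨c, hc, h⟩ := hbound k hk hk1
    -- The first two points are distinct, so the radius of the first `k + 1` points is comparable
    -- to that of all points.
    let i : Fin (k + 1) := ⟨1, by omega⟩
    have h01 : 0 < dist (a (Fin.castLE (Nat.succ_le_succ hk) 0))
        (a (Fin.castLE (Nat.succ_le_succ hk) i)) := by
      refine dist_nonneg.lt_of_ne fun h0 => hne (distDet_eq_zero_of_dist_eq_zero ?_ h0.symm)
      rw [(Fin.castLE_injective _).ne_iff, Ne, Fin.ext_iff]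
      simp [i]
    have htri := dist_triangle_right (a (Fin.castLE (Nat.succ_le_succ hk) 0))
      (a (Fin.castLE (Nat.succ_le_succ hk) i)) ⟨_, F.const_mem⟩
    obtain ⟨j, hj⟩ : ∃ j : Fin (k + 1),
        0 < dist (a (Fin.castLE (Nat.succ_le_succ hk) j)) ⟨_, F.const_mem⟩ := by
      by_contra! hall
      linarith [hall 0, hall i]
    exact F.distDet_pos_of_theta_ge hk1 (fun i => a (Fin.castLE (Nat.succ_le_succ hk) i)) hc h hj
  -- Flatness concerns sequences indexed by all of `ℕ`; members of the family are extended by `p`.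
  let E : F.Elem → ℕ → X := fun y => Function.extend φ y.1 fun _ => p
  have hE : ∀ y, Tendsto (E y) atTop (𝓝 p) := fun y =>
    hφ.tendsto_extend (pure_le_nhds p) (F.tendsto_of_mem y)
  have hEφ : ∀ y m, E y (φ m) = y.1 m := fun y m => hφ.injective.extend_apply _ _ _
  obtain ⟨f, hf⟩ := exists_isometry_of_distDet a hpos
    (fun y => by
      refine F.distDet_eq_zero_of_tendsto_theta (by omega) _
        (((hflat (E y) (E y) (hE y) (hE y)).1.comp hφ.tendsto_atTop).congr fun m => ?_)
      change theta p _ = _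
      congr 1
      ext i
      refine Fin.lastCases ?_ (fun i => ?_) i <;> simp [ha, hEφ])
    (fun y z => by
      refine F.distDet_eq_zero_of_tendsto_theta (by omega) _
        (((hflat (E y) (E z) (hE y) (hE z)).2.comp hφ.tendsto_atTop).congr fun m => ?_)
      change theta p _ = _
      congr 1
      ext i
      refine Fin.lastCases ?_ (fun i => ?_) i
      · simp [hEφ]
      · refine Fin.lastCases ?_ (fun i => ?_) i <;> simp [ha, hEφ])
  refine ⟨r, F, ⟨SeparationQuotient.lift f fun y z hyz => ?_, Isometry.of_dist_eq ?_⟩, ?_⟩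
  · rw [← dist_eq_zero, hf.dist_eq]
    exact Metric.inseparable_iff.1 hyz
  · intro y z
    obtain ⟨y, rfl⟩ := SeparationQuotient.surjective_mk y
    obtain ⟨z, rfl⟩ := SeparationQuotient.surjective_mk z
    rw [SeparationQuotient.lift_mk, SeparationQuotient.lift_mk, hf.dist_eq,
      SeparationQuotient.dist_mk]
  · rintro l hl ⟨f', hf'⟩
    have h0 := distDet_dist_eq_zero (k := n) (by simpa using hl)
      fun i => f' (SeparationQuotient.mk (a i))
    simp only [hf'.dist_eq, SeparationQuotient.dist_mk] at h0
    exact hne h0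

end MaximalSelfStableFamily

end Pretangent

theorem theorem4p2 {X : Type u} [MetricSpace X] (p : X) (n : ℕ) (hn : 1 ≤ n) :
    ((∃ (r : NormalizingSequence) (F : MaximalSelfStableFamily p r), F.IsTangent ∧
        EmbedsInEuclidean F.PretangentSpace n ∧
        ∀ l < n, ¬ EmbedsInEuclidean F.PretangentSpace l) →
      ∃ x : Fin (n + 1) → ℕ → X, IsNondegenerateFrame p x ∧ IsInfinitesimallyFlat p x) ∧
    ((∃ x : Fin (n + 1) → ℕ → X, IsNondegenerateFrame p x ∧ IsInfinitesimallyFlat p x) →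
      ∃ (r : NormalizingSequence) (F : MaximalSelfStableFamily p r),
        EmbedsInEuclidean F.PretangentSpace n ∧
        ∀ l < n, ¬ EmbedsInEuclidean F.PretangentSpace l) := by
  constructor
  · rintro ⟨r, F, hF, hE, hmin⟩
    exact hF.exists_frame hn hE hmin
  · rintro ⟨x, hx, hflat⟩
    exact MaximalSelfStableFamily.exists_embeds_of_frame hn hx hflat
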